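/- Let $\mathbb{F}_q$ be a finite field, let $k,m\ge 1$ be integers, and let $\mathrm{Mat}(k\times m,\mathbb{F}_q)$ be the $\mathbb{F}_q$-vector space of $k\times m$ matrices over $\mathbb{F}_q$. A code is an $\mathbb{F}_q$-linear subspace $\mathcal{C}\subseteq \mathrm{Mat}(k\times m,\mathbb{F}_q)$. Its maximum rank is $\mathrm{maxrk}(\mathcal{C})=\max\{\mathrm{rk}(M): M\in\mathcal{C}\}$, and its dual is $$\mathcal{C}^\perp=\{N\in \mathrm{Mat}(k\times m,\mathbb{F}_q): \mathrm{Tr}(MN^{t})=0 \text{ for all } M\in\mathcal{C}\}.$$ Every code satisfies $\dim_{\mathbb{F}_q}(\mathcal{C})\le \max\{k,m\}\cdot\mathrm{maxrk}(\mathcal{C})$, and $\mathcal{C}$ is called an optimal anticode if equality holds, that is, if $\dim_{\mathbb{F}_q}(\mathcal{C})= \max\{k,m\}\cdot\mathrm{maxrk}(\mathcal{C})$. Theorem. If $\mathcal{C}\subseteq \mathrm{Mat}(k\times m,\mathbb{F}_q)$ is an optimal anticode, then $\mathcal{C}^\perp$ is also an optimal anticode. -/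

import Mathlib

namespace RankMetric

/-- A (Delsarte rank-metric) code of size `k × m` over `F`: an `F`-linear subspace of the space of
`k × m` matrices. -/
abbrev Code (F : Type*) [Field F] (k m : ℕ) : Type _ :=
  Submodule F (Matrix (Fin k) (Fin m) F)

/-- The trace product `⟨M, N⟩ = Tr (M Nᵗ)`. -/
def traceProduct {F : Type*} [Field F] {k m : ℕ} (M N : Matrix (Fin k) (Fin m) F) : F :=
  (M * N.transpose).trace

/-- The (trace-)dual code: all `N` with `⟨M, N⟩ = 0` for every `M` in `C`. -/
def dual {F : Type*} [Field F] {k m : ℕ} (C : Code F k m) : Code F k m where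
  carrier := {N | ∀ M ∈ C, traceProduct M N = 0}
  zero_mem' := by
    intro M _
    simp [traceProduct]
  add_mem' := by
    intro A B hA hB M hM
    have h1 := hA M hM
    have h2 := hB M hM
    simp only [traceProduct] at h1 h2 ⊢
    rw [Matrix.transpose_add, Matrix.mul_add, Matrix.trace_add, h1, h2, add_zero]
  smul_mem' := by
    intro c A hA M hM
    have h1 := hA M hM
    simp only [traceProduct] at h1 ⊢
    rw [Matrix.transpose_smul, Matrix.mul_smul, Matrix.trace_smul, h1, smul_zero]

/-- The maximum rank of a code. -/
noncomputable def maxrk {F : Type*} [Field F] {k m : ℕ} (C : Code F k m) : ℕ :=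
  sSup {r : ℕ | ∃ M ∈ C, M.rank = r}

/-- The supremum defining `maxrk` is an attained maximum. -/
theorem isGreatest_maxrk {F : Type*} [Field F] {k m : ℕ} (C : Code F k m) :
    IsGreatest {r : ℕ | ∃ M ∈ C, M.rank = r} (maxrk C) := by
  have hb : BddAbove {r : ℕ | ∃ M ∈ C, M.rank = r} := by
    refine ⟨k, ?_⟩
    rintro r ⟨M, _, rfl⟩
    exact M.rank_le_height
  exact ⟨Nat.sSup_mem ⟨_, 0, C.zero_mem, rfl⟩ hb, fun r hr => le_csSup hb hr⟩

/-- An optimal anticode: a code attaining the upper bound `dim C ≤ max {k, m} * maxrk C`. -/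
def IsOptimalAnticode {F : Type*} [Field F] {k m : ℕ} (C : Code F k m) : Prop :=
  Module.finrank F C = max k m * maxrk C

end RankMetric

namespace RankMetric

open Module

/-! Transposing if necessary, let `m ≤ k`, and identify columns with the field `L` of degree `k`
over `F`. A Gabidulin code with `m - r` coefficients has dimension `(m - r) * k`, and its nonzero
members have rank above `r`, so it meets a code of maximum rank `r` trivially. This gives the
anticode bound; an optimal anticode is moreover a complement of every such Gabidulin code.

If a dual element `g` had rank above `m - r`, `exists_gabidulin_trace_comp_eq_zero` would choose the
embedding `ι` so that `g` is also orthogonal to the Gabidulin code. Then `g` is orthogonal to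
everything, hence zero: a contradiction. So the dual has maximum rank at most `m - r`, and dimension
exactly `(m - r) * k`; the anticode bound forces equality. -/

/-- Cyclicity of the trace against multiplication by `b` lets `b` be replaced by `σ b` in the
coefficient; a `b` moved by `σ` then kills every trace. -/
theorem trace_smul_algHom {F L : Type*} [Field F] [Field L] [Algebra F L]
    {σ : L →ₐ[F] L} (hσ : σ ≠ 1) (a : L) :
    LinearMap.trace F L (a • σ.toLinearMap) = 0 := by
  obtain ⟨b, hb⟩ : ∃ b, σ b ≠ b := by
    by_contra! h
    exact hσ (AlgHom.ext h)
  have key (c : L) : LinearMap.trace F L ((c * b) • σ.toLinearMap) =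
      LinearMap.trace F L ((c * σ b) • σ.toLinearMap) := by
    have h := LinearMap.trace_mul_comm F (LinearMap.mulLeft F b) (c • σ.toLinearMap)
    convert h using 2
    · ext x
      simp [mul_comm, mul_assoc]
    · ext x
      simp [mul_assoc]
  have hb' : σ b - b ≠ 0 := sub_ne_zero.mpr hb
  have ha : a • σ.toLinearMap = (a / (σ b - b) * σ b) • σ.toLinearMap -
      (a / (σ b - b) * b) • σ.toLinearMap := by
    ext x
    simp only [LinearMap.sub_apply, LinearMap.smul_apply, smul_eq_mul]
    field_simp
  rw [ha, map_sub, key, sub_self]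

/-! ### Linearized polynomials over a finite field -/

section LinearizedPolynomial

variable (F L : Type*) [Field F] [Fintype F] [Field L] [Algebra F L]

/-- The `F`-linear endomorphism `x ↦ ∑ i < d, a i * x ^ (q ^ i)` of an extension `L` of the field
`F` with `q` elements. -/
noncomputable def linearized (d : ℕ) : (Fin d → L) →ₗ[L] L →ₗ[F] L :=
  Fintype.linearCombination L fun i : Fin d =>
    (FiniteField.frobeniusAlgHom F L ^ (i : ℕ)).toLinearMap

variable {F L}

theorem frobeniusAlgHom_pow_apply (i : ℕ) (x : L) :
    (FiniteField.frobeniusAlgHom F L ^ i) x = x ^ Fintype.card F ^ i := by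
  rw [AlgHom.coe_pow, FiniteField.coe_frobeniusAlgHom, pow_iterate]

theorem linearized_eq_sum {d : ℕ} (a : Fin d → L) :
    linearized F L d a =
      ∑ i, a i • (FiniteField.frobeniusAlgHom F L ^ (i : ℕ)).toLinearMap := by
  simp [linearized, Fintype.linearCombination_apply]

theorem linearized_apply {d : ℕ} (a : Fin d → L) (x : L) :
    linearized F L d a x = ∑ i, a i * x ^ Fintype.card F ^ (i : ℕ) := by
  simp [linearized_eq_sum, LinearMap.sum_apply, frobeniusAlgHom_pow_apply]

/-- Root count: the kernel consists of roots of a nonzero polynomial of degree at most `q ^ (d -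
1)`. -/
theorem finrank_ker_linearized_lt [Finite L] {d : ℕ} {a : Fin d → L} (ha : a ≠ 0) :
    finrank F (LinearMap.ker (linearized F L d a)) < d := by
  classical
  set q := Fintype.card F
  have hq : 1 < q := Fintype.one_lt_card
  obtain ⟨j, hj⟩ := Function.ne_iff.mp ha
  have hd : 0 < d := j.pos
  set p : Polynomial L := ∑ i : Fin d, Polynomial.C (a i) * Polynomial.X ^ q ^ (i : ℕ) with hp
  have hp0 : p ≠ 0 := by
    intro h
    have hc : p.coeff (q ^ (j : ℕ)) = a j := by
      rw [hp, Polynomial.finsetSum_coeff, Finset.sum_eq_single j]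
      · simp
      · intro i _ hij
        rw [Polynomial.coeff_C_mul_X_pow, if_neg]
        exact fun h => hij (Fin.ext (Nat.pow_right_injective hq h).symm)
      · simp
    exact hj (by simpa [h] using hc.symm)
  have hdeg : p.natDegree ≤ q ^ (d - 1) := by
    refine Polynomial.natDegree_sum_le_of_forall_le _ _ fun i _ => ?_
    refine (Polynomial.natDegree_C_mul_X_pow_le _ _).trans ?_
    exact Nat.pow_le_pow_right hq.le (by omega)
  have hsub : ((LinearMap.ker (linearized F L d a) : Set L)) ⊆ p.roots.toFinset := by
    intro x hx
    have hx' : linearized F L d a x = 0 := hx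
    rw [linearized_apply] at hx'
    rw [Finset.mem_coe, Multiset.mem_toFinset, Polynomial.mem_roots hp0,
      Polynomial.IsRoot.def, hp, Polynomial.eval_finsetSum]
    simpa using hx'
  have hcard : q ^ finrank F (LinearMap.ker (linearized F L d a)) ≤ q ^ (d - 1) := by
    calc q ^ finrank F (LinearMap.ker (linearized F L d a))
        = Nat.card (LinearMap.ker (linearized F L d a)) := by
          rw [Module.natCard_eq_pow_finrank (K := F), Nat.card_eq_fintype_card (α := F)]
      _ ≤ p.roots.toFinset.card := by
          rw [← Nat.card_eq_finsetCard]
          exact Nat.card_mono (Finset.finite_toSet _) hsub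
      _ ≤ p.natDegree := (Multiset.toFinset_card_le _).trans (Polynomial.card_roots' p)
      _ ≤ _ := hdeg
  have := (Nat.pow_le_pow_iff_right hq).mp hcard
  omega

/-- Vanishing on `K` imposes `dim K` conditions over `L` on `dim K + 1` coefficients; the root count
prevents a larger kernel. -/
theorem exists_ker_linearized_eq [Finite L] (K : Submodule F L) :
    ∃ a : Fin (finrank F K + 1) → L, LinearMap.ker (linearized F L _ a) = K := by
  set d := finrank F K
  let restr : (Fin (d + 1) → L) →ₗ[L] K →ₗ[F] L :=
    { toFun a := linearized F L (d + 1) a ∘ₗ K.subtype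
      map_add' a b := by rw [map_add, LinearMap.add_comp]
      map_smul' c a := by rw [map_smul, LinearMap.smul_comp]; rfl }
  have hlt : finrank L (K →ₗ[F] L) < finrank L (Fin (d + 1) → L) := by
    rw [finrank_linearMap_self, finrank_fin_fun]
    exact Nat.lt_succ_self d
  obtain ⟨a, ha, ha0⟩ :=
    (Submodule.ne_bot_iff _).mp (LinearMap.ker_ne_bot_of_finrank_lt (f := restr) hlt)
  refine ⟨a, ?_⟩
  have hle : K ≤ LinearMap.ker (linearized F L (d + 1) a) := fun x hx =>
    LinearMap.congr_fun (LinearMap.mem_ker.mp ha) ⟨x, hx⟩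
  exact (Submodule.eq_of_le_of_finrank_le hle
    (Nat.lt_succ_iff.mp (finrank_ker_linearized_lt ha0))).symm

/-- The Frobenius exponents `i + j + 1` lie strictly between `0` and the order of Frobenius, so the
identity never occurs. The extra Frobenius factor excludes exponent `0`. -/
theorem trace_linearized_comp [Finite L] {d e : ℕ} (h : d + e ≤ finrank F L) (a : Fin d → L)
    (b : Fin e → L) :
    LinearMap.trace F L (linearized F L d a ∘ₗ linearized F L e b ∘ₗ
      (FiniteField.frobeniusAlgHom F L).toLinearMap) = 0 := by
  have hterm (i : Fin d) (j : Fin e) :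
      (a i • (FiniteField.frobeniusAlgHom F L ^ (i : ℕ)).toLinearMap) ∘ₗ
        (b j • (FiniteField.frobeniusAlgHom F L ^ (j : ℕ)).toLinearMap) ∘ₗ
          (FiniteField.frobeniusAlgHom F L).toLinearMap =
      (a i * (FiniteField.frobeniusAlgHom F L ^ (i : ℕ)) (b j)) •
        (FiniteField.frobeniusAlgHom F L ^ (i + j + 1 : ℕ)).toLinearMap := by
    ext x
    simp [pow_add, mul_assoc]
  have hsum : linearized F L d a ∘ₗ linearized F L e b ∘ₗ
      (FiniteField.frobeniusAlgHom F L).toLinearMap =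
      ∑ i, ∑ j, (a i * (FiniteField.frobeniusAlgHom F L ^ (i : ℕ)) (b j)) •
        (FiniteField.frobeniusAlgHom F L ^ (i + j + 1 : ℕ)).toLinearMap := by
    simp only [← hterm, linearized_eq_sum]
    ext x
    simp only [LinearMap.sum_apply, LinearMap.comp_apply, map_sum, LinearMap.smul_apply]
    exact Finset.sum_comm
  simp only [hsum, map_sum]
  refine Finset.sum_eq_zero fun i _ => Finset.sum_eq_zero fun j _ => trace_smul_algHom ?_ _
  rw [Ne, ← orderOf_dvd_iff_pow_eq_one, FiniteField.orderOf_frobeniusAlgHom]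
  intro hdvd
  have := Nat.le_of_dvd (Nat.succ_pos _) hdvd
  omega

end LinearizedPolynomial

/-! ### Linear maps with equal kernels -/

section LinearMap

variable {F U V W : Type*} [Field F] [AddCommGroup U] [Module F U] [AddCommGroup V] [Module F V]
  [AddCommGroup W] [Module F W]

theorem exists_injective_linearMap [FiniteDimensional F V] [FiniteDimensional F W]
    (h : finrank F V ≤ finrank F W) : ∃ f : V →ₗ[F] W, Function.Injective f := by
  let b := finBasis F V
  let c := finBasis F W
  refine ⟨b.constr F (c ∘ Fin.castLE h), ?_⟩
  exact b.injective_constr_of_linearIndependent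
    (c.linearIndependent.comp _ (Fin.castLE_injective h))

/-- Two linear maps with the same kernel differ by an injective map between their codomains. -/
theorem exists_injective_comp_eq [FiniteDimensional F V] [FiniteDimensional F W]
    (h : finrank F V ≤ finrank F W) (f : U →ₗ[F] V) (g : U →ₗ[F] W)
    (hfg : LinearMap.ker f = LinearMap.ker g) :
    ∃ ι : V →ₗ[F] W, Function.Injective ι ∧ ι ∘ₗ f = g := by
  let e : LinearMap.range f ≃ₗ[F] LinearMap.range g :=
    f.quotKerEquivRange.symm ≪≫ₗ Submodule.quotEquivOfEq _ _ hfg ≪≫ₗ g.quotKerEquivRange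
  obtain ⟨A, hA⟩ := (LinearMap.range f).exists_isCompl
  obtain ⟨B, hB⟩ := (LinearMap.range g).exists_isCompl
  -- The ranges are isomorphic, so the complements inherit the inequality of dimensions.
  obtain ⟨j, hj⟩ : ∃ j : A →ₗ[F] B, Function.Injective j := by
    apply exists_injective_linearMap
    have h1 := Submodule.finrank_add_eq_of_isCompl hA
    have h2 := Submodule.finrank_add_eq_of_isCompl hB
    have h3 := e.finrank_eq
    omega
  refine ⟨(Submodule.prodEquivOfIsCompl _ _ hB).toLinearMap ∘ₗ (e.toLinearMap.prodMap j) ∘ₗ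
    (Submodule.prodEquivOfIsCompl _ _ hA).symm.toLinearMap, ?_, ?_⟩
  · simp only [LinearMap.coe_comp, LinearEquiv.coe_coe, LinearMap.coe_prodMap]
    exact (LinearEquiv.injective _).comp
      ((e.injective.prodMap hj).comp (LinearEquiv.injective _))
  · ext x
    have hx : (Submodule.prodEquivOfIsCompl _ _ hA).symm (f x) =
        (f.rangeRestrict x, 0) :=
      Submodule.prodEquivOfIsCompl_symm_apply_left _ _ hA (f.rangeRestrict x)
    have he : e (f.rangeRestrict x) = g.rangeRestrict x := by
      have h1 : f.quotKerEquivRange.symm (f.rangeRestrict x) =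
          Submodule.Quotient.mk x := f.quotKerEquivRange_symm_apply_image x _
      simp only [e, LinearEquiv.trans_apply, h1, Submodule.quotEquivOfEq_mk]
      rfl
    simp only [LinearMap.comp_apply, LinearEquiv.coe_coe, hx, LinearMap.prodMap_apply, he,
      map_zero, Submodule.coe_prodEquivOfIsCompl']
    simp

end LinearMap

/-! ### Gabidulin codes and the anticode bound -/

section Gabidulin

variable {F L W : Type*} [Field F] [Fintype F] [Field L] [Algebra F L] [AddCommGroup W]
  [Module F W]

/-- The linearized polynomial maps with `t` coefficients, restricted along `ι : W → L`. -/
noncomputable def gabidulin (t : ℕ) (ι : W →ₗ[F] L) : Submodule F (W →ₗ[F] L) :=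
  LinearMap.range (LinearMap.lcomp F L ι ∘ₗ (linearized F L t).restrictScalars F)

variable [Finite L] [FiniteDimensional F W] {ι : W →ₗ[F] L}

theorem finrank_lt_finrank_range_linearized_comp_add (hι : Function.Injective ι) {t : ℕ}
    {a : Fin t → L} (ha : a ≠ 0) :
    finrank F W < finrank F (LinearMap.range (linearized F L t a ∘ₗ ι)) + t := by
  have h1 := LinearMap.finrank_range_add_finrank_ker (linearized F L t a ∘ₗ ι)
  have h2 : finrank F (LinearMap.ker (linearized F L t a ∘ₗ ι)) ≤
      finrank F (LinearMap.ker (linearized F L t a)) := by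
    rw [LinearMap.ker_comp]
    refine LinearMap.finrank_le_finrank_of_injective
      (f := ι.restrict (p := (LinearMap.ker (linearized F L t a)).comap ι)
        (q := LinearMap.ker (linearized F L t a)) fun x hx => hx) ?_
    intro x y hxy
    exact Subtype.ext (hι (congrArg Subtype.val hxy))
  have h3 := finrank_ker_linearized_lt (F := F) ha
  omega

theorem finrank_gabidulin (hι : Function.Injective ι) {t : ℕ} (ht : t ≤ finrank F W) :
    finrank F (gabidulin t ι) = t * finrank F L := by
  rw [gabidulin, LinearMap.finrank_range_of_inj, finrank_pi_fintype, Finset.sum_const,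
    Finset.card_univ, Fintype.card_fin, smul_eq_mul]
  rw [injective_iff_map_eq_zero]
  intro a ha
  by_contra h
  have h1 := finrank_lt_finrank_range_linearized_comp_add hι h
  rw [show linearized F L t a ∘ₗ ι = 0 from ha, LinearMap.range_zero, finrank_bot] at h1
  omega

theorem disjoint_gabidulin (hι : Function.Injective ι) {r : ℕ} {C : Submodule F (W →ₗ[F] L)}
    (hC : ∀ f ∈ C, finrank F (LinearMap.range f) ≤ r) (hr : r ≤ finrank F W) :
    Disjoint C (gabidulin (finrank F W - r) ι) := by
  rw [Submodule.disjoint_def]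
  rintro f hf ⟨a, rfl⟩
  by_contra h
  have ha : a ≠ 0 := by
    rintro rfl
    exact h (map_zero _)
  have h1 := finrank_lt_finrank_range_linearized_comp_add hι ha
  have h2 := hC _ hf
  rw [show (LinearMap.lcomp F L ι ∘ₗ (linearized F L _).restrictScalars F) a =
    linearized F L _ a ∘ₗ ι from rfl] at h2
  omega

/-- A space of linear maps of rank at most `r` from `W` to a space at least as large has dimension
at most `r` times that of the codomain. -/
theorem finrank_le_of_finrank_range_le (hWL : finrank F W ≤ finrank F L) {r : ℕ}
    {C : Submodule F (W →ₗ[F] L)} (hC : ∀ f ∈ C, finrank F (LinearMap.range f) ≤ r)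
    (hr : r ≤ finrank F W) : finrank F C ≤ r * finrank F L := by
  obtain ⟨ι, hι⟩ := exists_injective_linearMap hWL
  have h1 := Submodule.finrank_add_finrank_le_of_disjoint (disjoint_gabidulin hι hC hr)
  rw [finrank_gabidulin hι (Nat.sub_le _ _), finrank_linearMap] at h1
  obtain ⟨t, ht⟩ := Nat.exists_eq_add_of_le hr
  rw [ht, Nat.add_sub_cancel_left, add_mul] at h1
  omega

/-- Every linear map `g` of rank larger than `t` is orthogonal to some Gabidulin code with `t`
coefficients. -/
theorem exists_gabidulin_trace_comp_eq_zero (hWL : finrank F W ≤ finrank F L) {t : ℕ}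
    (g : L →ₗ[F] W) (ht : t < finrank F (LinearMap.range g)) :
    ∃ ι : W →ₗ[F] L, Function.Injective ι ∧
      ∀ f ∈ gabidulin t ι, LinearMap.trace F W (g ∘ₗ f) = 0 := by
  let φ : L →ₗ[F] L := (FiniteField.frobeniusAlgHom F L).toLinearMap
  have hφ : Function.Injective φ := (FiniteField.frobeniusAlgHom F L).injective
  -- Taking the image under `φ` makes `b ∘ φ`, rather than `b`, share the kernel of `g`, as the
  -- trace lemma requires.
  obtain ⟨b, hb⟩ := exists_ker_linearized_eq ((LinearMap.ker g).map φ)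
  have hker : LinearMap.ker g = LinearMap.ker (linearized F L _ b ∘ₗ φ) := by
    rw [LinearMap.ker_comp, hb, Submodule.comap_map_eq_of_injective hφ]
  obtain ⟨ι, hι, hιg⟩ := exists_injective_comp_eq hWL g _ hker
  refine ⟨ι, hι, ?_⟩
  rintro _ ⟨a, rfl⟩
  change LinearMap.trace F W (g ∘ₗ linearized F L t a ∘ₗ ι) = 0
  rw [← LinearMap.trace_comp_comm', LinearMap.comp_assoc, hιg]
  apply trace_linearized_comp
  have h1 := LinearMap.finrank_range_add_finrank_ker g
  have h2 : finrank F ((LinearMap.ker g).map φ) = finrank F (LinearMap.ker g) :=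
    ((LinearMap.ker g).equivMapOfInjective φ hφ).finrank_eq.symm
  -- Here `b` has `dim L - rank g + 1` coefficients, so `t < rank g` is exactly the bound needed.
  omega

/-- If a space of linear maps of rank at most `r` attains the maximal dimension, then the maps
orthogonal to it under the trace pairing have rank at most `dim W - r`. -/
theorem finrank_range_add_le_of_trace_comp_eq_zero (hWL : finrank F W ≤ finrank F L) {r : ℕ}
    {C : Submodule F (W →ₗ[F] L)} (hC : ∀ f ∈ C, finrank F (LinearMap.range f) ≤ r)
    (hr : r ≤ finrank F W) (hdim : finrank F C = r * finrank F L) (g : L →ₗ[F] W)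
    (hg : ∀ f ∈ C, LinearMap.trace F W (g ∘ₗ f) = 0) :
    finrank F (LinearMap.range g) + r ≤ finrank F W := by
  by_contra! hlt
  obtain ⟨ι, hι, hD⟩ := exists_gabidulin_trace_comp_eq_zero hWL g
    (show finrank F W - r < _ by omega)
  have htop : C ⊔ gabidulin (finrank F W - r) ι = ⊤ := by
    apply Submodule.eq_top_of_disjoint _ _ _ (disjoint_gabidulin hι hC hr)
    rw [hdim, finrank_gabidulin hι (Nat.sub_le _ _), ← add_mul, Nat.add_sub_cancel' hr,
      finrank_linearMap]
  have hzero (f : W →ₗ[F] L) : LinearMap.trace F W (g ∘ₗ f) = 0 := by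
    obtain ⟨x, hx, y, hy, rfl⟩ := Submodule.mem_sup.mp (htop ▸ Submodule.mem_top : f ∈ _)
    rw [LinearMap.comp_add, map_add, hg x hx, hD y hy, add_zero]
  have hg0 : g = 0 := by
    ext x
    rw [LinearMap.zero_apply, ← Module.forall_dual_apply_eq_zero_iff F]
    intro φ
    -- Testing against rank-one maps recovers `φ (g x)` as a trace.
    have hcomp : g ∘ₗ φ.smulRight x = φ.smulRight (g x) := by
      ext y
      simp
    rw [← LinearMap.trace_smulRight, ← hcomp, hzero]
  rw [hg0, LinearMap.range_zero, finrank_bot] at hlt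
  omega

end Gabidulin

theorem exists_finiteField_extension (F : Type*) [Field F] [Finite F] {n : ℕ} (hn : 0 < n) :
    ∃ (L : Type) (_ : Field L) (_ : Algebra F L), Finite L ∧ finrank F L = n := by
  obtain ⟨p, hp⟩ := CharP.exists F
  have : Fact p.Prime := ⟨CharP.char_is_prime F p⟩
  have : NeZero n := ⟨hn.ne'⟩
  exact ⟨FiniteField.Extension F p n, inferInstance, inferInstance, inferInstance,
    FiniteField.finrank_extension F p n⟩

/-! ### Duality and transposition of codes -/

section Dual

variable {F : Type*} [Field F] {k m : ℕ}

/-- The trace product as a bilinear form. -/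
def traceForm (F : Type*) [Field F] (k m : ℕ) :
    LinearMap.BilinForm F (Matrix (Fin k) (Fin m) F) :=
  LinearMap.mk₂ F traceProduct
    (fun A B C => by simp [traceProduct, Matrix.add_mul])
    (fun c A B => by simp [traceProduct])
    (fun A B C => by simp [traceProduct, Matrix.mul_add])
    (fun c A B => by simp [traceProduct])

theorem traceProduct_comm (M N : Matrix (Fin k) (Fin m) F) :
    traceProduct M N = traceProduct N M := by
  rw [traceProduct, ← Matrix.trace_transpose, Matrix.transpose_mul, Matrix.transpose_transpose,
    traceProduct]

theorem traceProduct_transpose (M N : Matrix (Fin k) (Fin m) F) :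
    traceProduct M.transpose N.transpose = traceProduct M N := by
  rw [traceProduct, traceProduct, Matrix.transpose_transpose, Matrix.trace_mul_comm,
    ← Matrix.trace_transpose, Matrix.transpose_mul, Matrix.transpose_transpose]

theorem traceForm_nondegenerate : (traceForm F k m).Nondegenerate := by
  have h : (traceForm F k m).SeparatingLeft := by
    intro M hM
    ext i j
    have h : traceProduct M (Matrix.single i j 1) = 0 := hM _
    simpa [traceProduct, Matrix.trace_mul_single] using h
  refine ⟨h, fun M hM => h M fun N => ?_⟩
  exact (traceProduct_comm M N).trans (hM N)

theorem finrank_dual (C : Code F k m) : finrank F (dual C) = k * m - finrank F C := by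
  have h := LinearMap.BilinForm.finrank_orthogonal (traceForm_nondegenerate (F := F)) C
  rw [finrank_matrix, finrank_self, mul_one, Fintype.card_fin, Fintype.card_fin] at h
  exact h

/-- Transposition of a code. -/
def transposeCode (C : Code F k m) : Code F m k :=
  C.map (Matrix.transposeLinearEquiv (Fin k) (Fin m) F F).toLinearMap

theorem mem_transposeCode {C : Code F k m} {M : Matrix (Fin m) (Fin k) F} :
    M ∈ transposeCode C ↔ M.transpose ∈ C := by
  constructor
  · rintro ⟨N, hN, rfl⟩
    exact hN
  · exact fun h => ⟨M.transpose, h, rfl⟩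

theorem finrank_transposeCode (C : Code F k m) : finrank F (transposeCode C) = finrank F C :=
  LinearEquiv.finrank_map_eq _ _

theorem dual_transposeCode (C : Code F k m) : dual (transposeCode C) = transposeCode (dual C) := by
  ext N
  rw [mem_transposeCode]
  constructor
  · intro h M hM
    rw [← traceProduct_transpose, Matrix.transpose_transpose]
    exact h _ (mem_transposeCode.mpr hM)
  · intro h M hM
    rw [← traceProduct_transpose]
    exact h _ (mem_transposeCode.mp hM)

theorem maxrk_transposeCode (C : Code F k m) : maxrk (transposeCode C) = maxrk C := by
  unfold maxrk
  congr 1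
  ext r
  constructor
  · rintro ⟨M, hM, rfl⟩
    exact ⟨_, mem_transposeCode.mp hM, M.rank_transpose⟩
  · rintro ⟨M, hM, rfl⟩
    exact ⟨M.transpose, mem_transposeCode.mpr hM, M.rank_transpose⟩

theorem isOptimalAnticode_transposeCode {C : Code F k m} :
    IsOptimalAnticode (transposeCode C) ↔ IsOptimalAnticode C := by
  rw [IsOptimalAnticode, IsOptimalAnticode, finrank_transposeCode, maxrk_transposeCode, max_comm]

theorem rank_le_maxrk {C : Code F k m} {M : Matrix (Fin k) (Fin m) F} (hM : M ∈ C) :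
    M.rank ≤ maxrk C :=
  (isGreatest_maxrk C).2 ⟨M, hM, rfl⟩

theorem maxrk_le_iff {C : Code F k m} {r : ℕ} : maxrk C ≤ r ↔ ∀ M ∈ C, M.rank ≤ r := by
  refine ⟨fun h M hM => (rank_le_maxrk hM).trans h, fun h => ?_⟩
  obtain ⟨M, hM, hr⟩ := (isGreatest_maxrk C).1
  exact hr ▸ h M hM

theorem maxrk_le_width (C : Code F k m) : maxrk C ≤ m :=
  maxrk_le_iff.mpr fun M _ => M.rank_le_width

end Dual

/-! ### From matrices to linear maps -/

section Transfer

variable {F L : Type*} [Field F] [Field L] [Algebra F L] {k m : ℕ}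

/-- Matrices as linear maps into a space `L` identified with the space of columns. -/
noncomputable def matrixEquivLinearMap (e : (Fin k → F) ≃ₗ[F] L) :
    Matrix (Fin k) (Fin m) F ≃ₗ[F] (Fin m → F) →ₗ[F] L :=
  Matrix.toLin' ≪≫ₗ e.congrRight

theorem matrixEquivLinearMap_apply (e : (Fin k → F) ≃ₗ[F] L) (M : Matrix (Fin k) (Fin m) F) :
    matrixEquivLinearMap e M = e.toLinearMap ∘ₗ M.toLin' :=
  rfl

theorem finrank_range_matrixEquivLinearMap (e : (Fin k → F) ≃ₗ[F] L)
    (M : Matrix (Fin k) (Fin m) F) :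
    finrank F (LinearMap.range (matrixEquivLinearMap e M)) = M.rank := by
  rw [matrixEquivLinearMap_apply, LinearMap.range_comp]
  exact LinearEquiv.finrank_map_eq e _

theorem finrank_range_of_mem_map {C : Code F k m} (e : (Fin k → F) ≃ₗ[F] L)
    {f : (Fin m → F) →ₗ[F] L} (hf : f ∈ C.map (matrixEquivLinearMap e).toLinearMap) :
    finrank F (LinearMap.range f) ≤ maxrk C := by
  obtain ⟨M, hM, rfl⟩ := hf
  exact (finrank_range_matrixEquivLinearMap e M).trans_le (rank_le_maxrk hM)

end Transfer

/-! ### Optimal anticodes -/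

section Anticode

variable {F : Type*} [Field F] [Finite F] {k m : ℕ}

theorem finrank_le_mul_maxrk (hk : 0 < k) (hmk : m ≤ k) (C : Code F k m) :
    finrank F C ≤ maxrk C * k := by
  have := Fintype.ofFinite F
  obtain ⟨L, _, _, _, hL⟩ := exists_finiteField_extension F hk
  let e : (Fin k → F) ≃ₗ[F] L := LinearEquiv.ofFinrankEq _ _ (by rw [finrank_fin_fun, hL])
  have h := finrank_le_of_finrank_range_le (by rwa [finrank_fin_fun, hL])
    (fun f => finrank_range_of_mem_map (C := C) e) (by simpa using maxrk_le_width C)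
  rwa [LinearEquiv.finrank_map_eq, hL] at h

theorem rank_add_maxrk_le (hk : 0 < k) (hmk : m ≤ k) {C : Code F k m}
    (hC : finrank F C = maxrk C * k) {N : Matrix (Fin k) (Fin m) F} (hN : N ∈ dual C) :
    N.rank + maxrk C ≤ m := by
  have := Fintype.ofFinite F
  obtain ⟨L, _, _, _, hL⟩ := exists_finiteField_extension F hk
  let e : (Fin k → F) ≃ₗ[F] L := LinearEquiv.ofFinrankEq _ _ (by rw [finrank_fin_fun, hL])
  have h := finrank_range_add_le_of_trace_comp_eq_zero (by rwa [finrank_fin_fun, hL])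
    (fun f => finrank_range_of_mem_map (C := C) e) (by simpa using maxrk_le_width C)
    (by rw [LinearEquiv.finrank_map_eq, hL, hC])
    (N.transpose.toLin' ∘ₗ e.symm.toLinearMap) ?_
  · rw [LinearMap.range_comp_of_range_eq_top _ e.symm.range, finrank_fin_fun] at h
    rw [← N.rank_transpose]
    exact h
  · rintro _ ⟨M, hM, rfl⟩
    have hcomp : (N.transpose.toLin' ∘ₗ e.symm.toLinearMap) ∘ₗ matrixEquivLinearMap e M =
        (N.transpose * M).toLin' := by
      ext x
      simp [matrixEquivLinearMap_apply]
    rw [LinearEquiv.coe_coe, hcomp, Matrix.trace_toLin'_eq, Matrix.trace_mul_comm]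
    exact hN M hM

theorem isOptimalAnticode_dual_of_le (hk : 0 < k) (hmk : m ≤ k) {C : Code F k m}
    (hC : IsOptimalAnticode C) : IsOptimalAnticode (dual C) := by
  rw [IsOptimalAnticode, max_eq_left hmk, mul_comm] at hC ⊢
  have h1 : maxrk (dual C) ≤ m - maxrk C := maxrk_le_iff.mpr fun N hN =>
    Nat.le_sub_of_add_le (rank_add_maxrk_le hk hmk hC hN)
  refine le_antisymm (finrank_le_mul_maxrk hk hmk _) ?_
  rw [finrank_dual, hC, mul_comm k m, ← Nat.sub_mul]
  exact Nat.mul_le_mul_right k h1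

end Anticode

end RankMetric

theorem theorem5p4 {F : Type*} [Field F] [Finite F] {k m : ℕ} (hk : 0 < k) (hm : 0 < m)
    (C : RankMetric.Code F k m) (hC : RankMetric.IsOptimalAnticode C) :
    RankMetric.IsOptimalAnticode (RankMetric.dual C) := by
  rcases le_total m k with h | h
  · exact RankMetric.isOptimalAnticode_dual_of_le hk h hC
  · rw [← RankMetric.isOptimalAnticode_transposeCode, ← RankMetric.dual_transposeCode]
    exact RankMetric.isOptimalAnticode_dual_of_le hm h
      (RankMetric.isOptimalAnticode_transposeCode.mpr hC)
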